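/- Let $c>0$, let $\Gamma_1=\Gamma_2=\Gamma\neq 0$ be the common charge of two vortices, and identify the space of skew-Hermitian $2\times2$ matrices with $\mathbb R^4$ by $$\mu=\mathrm i\begin{bmatrix}\mu_1&\mu_3+\mathrm i\mu_4\\ \mu_3-\mathrm i\mu_4&\mu_2\end{bmatrix}.$$ The relative dynamics of the two vortices (positions $z_1,z_2$ in the open unit disc, $\mu=\mathrm i zz^*$) is the Lie--Poisson equation $$\dot\mu=D^{-1}\frac{\delta h}{\delta\mu}\,\mu-\mu\,\frac{\delta h}{\delta\mu}D^{-1},\qquad D=\operatorname{diag}(\Gamma_1,\Gamma_2),\qquad(\ast)$$ on the domain $\{\mu_1<1,\ \mu_2<1,\ \mu_1+\mu_2-2\mu_3>0\}$, where $$h(\mu)=\tfrac12\bigl(\Gamma_1^2\ln(1-\mu_1)+\Gamma_2^2\ln(1-\mu_2)-c\,\Gamma_1\Gamma_2\ln(\mu_1+\mu_2-2\mu_3)\bigr)$$ and $\delta h/\delta\mu$ is the gradient of $h$ with respect to the inner product $\langle\xi,\eta\rangle=\frac12\operatorname{tr}(\xi^*\eta)$. Let $r_1,r_2\in[0,1)$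 with $r_1+r_2>0$, and let $\mu_0=(r_1^2,\,r_2^2,\,-r_1r_2,\,0)$. (i) (Equilibrium A.) If $r_1=r_2$, then $\mu_0$ is a fixed point of $(\ast)$. It is Lyapunov stable if $c(1-r_1^2)^2>4r_1^4$, and it is unstable if $c(1-r_1^2)^2<4r_1^4$. (ii) (Equilibrium B.) If $c(1-r_1^2)(1-r_2^2)=r_1r_2(r_1+r_2)^2$, then $\mu_0$ is a fixed point of $(\ast)$. Put $$F_1(r_1,r_2)=(r_1^2+r_2^2)^2+(r_1^2+r_2^2)(r_1^2r_2^2+4r_1r_2-3)+2(r_1-r_2)^2 .$$ Then $\mu_0$ is Lyapunov stable if $F_1(r_1,r_2)<0$, and it is unstable if $F_1(r_1,r_2)>0$. Here $\mu_0$ is Lyapunov stable if for every $\varepsilon>0$ there is a $\delta>0$ such that every initial value within $\delta$ of $\mu_0$ in $\mathbb R^4$ has a solution of $(\ast)$ for all $t\ge0$, and all solutions with that initial value stay within $\varepsilon$ of $\mu_0$ in forward time. Unstable means not Lyapunov stable; in both cases the instability already holds when only initial values of the form $\mathrm i zz^*$ with $z\in\mathbb C^2$ (actual configurations of two vortices)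 are considered. -/

import Mathlib

open Set

noncomputable section

namespace BECVortex

/-- Lyapunov stability of the point `x₀` for the autonomous equation `x' = X x` with phase space
`U`, tested on the initial values that belong to `S`: every initial value in `S` close enough to
`x₀` has a solution for all forward times, and every solution with that initial value (on whatever
interval `[0, T)` it is defined) stays close to `x₀`. Solutions have to remain in `U`. -/
def LyapunovStableOn {E : Type*} [NormedAddCommGroup E] [NormedSpace ℝ E]
    (X : E → E) (U S : Set E) (x₀ : E) : Prop :=
  ∀ ε : ℝ, 0 < ε → ∃ δ : ℝ, 0 < δ ∧ ∀ x ∈ S, dist x x₀ < δ →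
    (∃ γ : ℝ → E, γ 0 = x ∧ IsIntegralCurveOn γ (fun _ => X) (Ici 0) ∧ ∀ t ∈ Ici (0 : ℝ), γ t ∈ U) ∧
    ∀ (T : ℝ) (γ : ℝ → E), γ 0 = x → IsIntegralCurveOn γ (fun _ => X) (Ico 0 T) →
      (∀ t ∈ Ico 0 T, γ t ∈ U) → ∀ t ∈ Ico 0 T, dist (γ t) x₀ < ε

/-- Lyapunov stability with respect to all initial values. -/
def LyapunovStable {E : Type*} [NormedAddCommGroup E] [NormedSpace ℝ E]
    (X : E → E) (U : Set E) (x₀ : E) : Prop :=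
  LyapunovStableOn X U U x₀

/-- Coordinates `(μ₁, μ₂, μ₃, μ₄)` (with indices `0, 1, 2, 3`) on the space of skew-Hermitian
`2 × 2` matrices. -/
abbrev Shape : Type := EuclideanSpace ℝ (Fin 4)

/-- The skew-Hermitian matrix with coordinates `μ`. -/
def toMat (μ : Shape) : Matrix (Fin 2) (Fin 2) ℂ :=
  Complex.I • !![(μ 0 : ℂ), (μ 2 : ℂ) + Complex.I * (μ 3 : ℂ);
                 (μ 2 : ℂ) - Complex.I * (μ 3 : ℂ), (μ 1 : ℂ)]

/-- The coordinates of a skew-Hermitian `2 × 2` matrix. -/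
def coords (M : Matrix (Fin 2) (Fin 2) ℂ) : Shape :=
  !₂[(-Complex.I * M 0 0).re, (-Complex.I * M 1 1).re,
     (-Complex.I * M 0 1).re, (-Complex.I * M 0 1).im]

/-- The map `z ↦ i z z*`, in coordinates: the shape of the configuration `z` of two vortices. -/
def shapeOf (z : Fin 2 → ℂ) : Shape :=
  coords (Complex.I • Matrix.vecMulVec z (star z))

/-- Both vortices lie in the open unit disc and they do not collide; this is where the Hamiltonian
is defined. -/
def domain : Set Shape :=
  {μ | μ 0 < 1 ∧ μ 1 < 1 ∧ 0 < μ 0 + μ 1 - 2 * μ 2}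

/-- The Hamiltonian of two vortices with charges `Γ` as a function of the shape. -/
def ham (c : ℝ) (Γ : Fin 2 → ℝ) (μ : Shape) : ℝ :=
  (Γ 0 ^ 2 * Real.log (1 - μ 0) + Γ 1 ^ 2 * Real.log (1 - μ 1)
    - c * Γ 0 * Γ 1 * Real.log (μ 0 + μ 1 - 2 * μ 2)) / 2

/-- The partial derivative of `f` with respect to the coordinate `i`. -/
def pd (f : Shape → ℝ) (i : Fin 4) (μ : Shape) : ℝ :=
  lineDeriv ℝ f μ (EuclideanSpace.single i 1)

/-- The derivative `δf/δμ`: the gradient of `f` with respect to the inner product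
`⟨ξ, η⟩ = tr(ξ* η) / 2` on skew-Hermitian matrices. -/
def varDeriv (f : Shape → ℝ) (μ : Shape) : Matrix (Fin 2) (Fin 2) ℂ :=
  Complex.I • !![2 * (pd f 0 μ : ℂ), (pd f 2 μ : ℂ) + Complex.I * (pd f 3 μ : ℂ);
                 (pd f 2 μ : ℂ) - Complex.I * (pd f 3 μ : ℂ), 2 * (pd f 1 μ : ℂ)]

/-- The inverse of the diagonal matrix of the charges. -/
def chargeInv (Γ : Fin 2 → ℝ) : Matrix (Fin 2) (Fin 2) ℂ :=
  Matrix.diagonal fun i => ((Γ i : ℂ))⁻¹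

/-- The right-hand side of the Lie--Poisson equation
`μ' = D⁻¹ (δh/δμ) μ - μ (δh/δμ) D⁻¹`, as a vector field in the coordinates. -/
def lpField (c : ℝ) (Γ : Fin 2 → ℝ) (μ : Shape) : Shape :=
  coords (chargeInv Γ * varDeriv (ham c Γ) μ * toMat μ
    - toMat μ * varDeriv (ham c Γ) μ * chargeInv Γ)

/-- The point `(r₁², r₂², -r₁ r₂, 0)`: two vortices on opposite sides of the origin, at the
distances `r₁` and `r₂` from it. -/
def dumbbell (r₁ r₂ : ℝ) : Shape :=
  !₂[r₁ ^ 2, r₂ ^ 2, -(r₁ * r₂), 0]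

/-- The function whose sign decides the stability of the asymmetric configurations. -/
def F₁ (r₁ r₂ : ℝ) : ℝ :=
  (r₁ ^ 2 + r₂ ^ 2) ^ 2 + (r₁ ^ 2 + r₂ ^ 2) * (r₁ ^ 2 * r₂ ^ 2 + 4 * r₁ * r₂ - 3)
    + 2 * (r₁ - r₂) ^ 2

end BECVortex

end

/-! For equal charges D is scalar, so the field is a multiple of the commutator of δh/δμ and μ;
besides the energy it preserves the trace μ₁ + μ₂ and det μ. On the common level set through a
dumbbell, where det μ = 0, a point is fixed by d = μ₁ - μ₂ up to the sign of μ₄: the energy gives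
the squared distance s = μ₁ + μ₂ - 2μ₃ as a power of k = (1 - μ₁)(1 - μ₂), and det μ = 0 turns into
4μ₄² = P(d), the `dumbbellProfile` (`integrals_eq_dumbbell_iff`).

Stability is thus read off from the sign of P near d₀ = r₁² - r₂². If P < 0 on both sides, the
dumbbell is isolated in its level set, and a compactness argument traps nearby solutions
(`lyapunovStable_of_isolated`). If P > 0 to the right of d₀, start there with Γμ₄ > 0: since d' =
4cΓμ₄ / s, d increases, μ₄ cannot vanish, and d moves away at a speed bounded below
(`not_bounded_of_sq_eq`).

P depends on d only through k, which is maximal at d = 0. For equilibria A, d₀ = 0, so only k < k₀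
occurs and the first derivative in k decides. Condition B says that this derivative vanishes; the
second derivative then decides, and eliminating c makes it a positive multiple of `F₁`. -/

namespace BECVortex

open Filter Topology Metric
open scoped NNReal

/-! ### Conserved quantities and Lyapunov stability. -/

section ODE

variable {E : Type*} [NormedAddCommGroup E] [NormedSpace ℝ E]

/-- A bounded, globally Lipschitz vector field has global integral curves. -/
theorem exists_isIntegralCurve_of_lipschitzWith [CompleteSpace E] {Y : E → E} {K L : ℝ≥0}
    (hK : LipschitzWith K Y) (hL : ∀ x, ‖Y x‖ ≤ L) (x : E) :
    ∃ γ : ℝ → E, γ 0 = x ∧ IsIntegralCurve γ (fun _ => Y) := by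
  have key : ∀ n : ℕ, ∃ α : ℝ → E, α 0 = x ∧
      ∀ t ∈ Ioo (-(n + 1 : ℝ)) (n + 1), HasDerivAt α (Y (α t)) t := by
    intro n
    have hn : (0 : ℝ) ≤ n := n.cast_nonneg
    have h0 : (0 : ℝ) ∈ Icc (-(n + 1 : ℝ)) (n + 1) := ⟨by linarith, by linarith⟩
    -- In time `n + 1` a curve of speed at most `L` moves at most `L * (n + 1)`, so this radius
    -- imposes no restriction on the time.
    have hpl : IsPicardLindelof (fun _ => Y) (⟨0, h0⟩ : Icc (-(n + 1 : ℝ)) (n + 1)) x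
        (L * (n + 1)) 0 L K :=
      { lipschitzOnWith := fun _ _ => hK.lipschitzOnWith
        continuousOn := fun _ _ => continuousOn_const
        norm_le := fun _ _ y _ => hL y
        mul_max_le := by simp }
    obtain ⟨α, hα0, hα⟩ := hpl.exists_eq_forall_mem_Icc_hasDerivWithinAt₀
    exact ⟨α, hα0, fun t ht =>
      (hα t (Ioo_subset_Icc_self ht)).hasDerivAt (Icc_mem_nhds ht.1 ht.2)⟩
  choose α hα0 hα using key
  have huniq : ∀ m n : ℕ, m ≤ n → EqOn (α m) (α n) (Ioo (-(m + 1 : ℝ)) (m + 1)) := by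
    intro m n hmn
    have hm : (0 : ℝ) ≤ m := m.cast_nonneg
    have hmn' : (m : ℝ) ≤ n := by exact_mod_cast hmn
    refine ODE_solution_unique_of_mem_Ioo (v := fun _ => Y) (s := fun _ => univ) (t₀ := 0)
      (fun _ _ => hK.lipschitzOnWith) ⟨by linarith, by linarith⟩
      (fun t ht => ⟨hα m t ht, mem_univ _⟩)
      (fun t ht => ⟨hα n t ⟨by linarith [ht.1], by linarith [ht.2]⟩, mem_univ _⟩) ?_
    rw [hα0, hα0]
  -- Gluing: |t| < ⌊|t|⌋ + 1, so `t` lies in the interval of the solution with index ⌊|t|⌋, and by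
  -- uniqueness larger indices agree there.
  refine ⟨fun t => α ⌊|t|⌋₊ t, by simp [hα0], fun t => ?_⟩
  have hval : ∀ N : ℕ, ∀ t' : ℝ, |t'| < N + 1 → α ⌊|t'|⌋₊ t' = α N t' := by
    intro N t' ht'
    refine huniq _ _ ?_ (abs_lt.mp (Nat.lt_floor_add_one _))
    exact Nat.lt_succ_iff.mp ((Nat.floor_lt (abs_nonneg _)).2 (by exact_mod_cast ht'))
  set N := ⌊|t|⌋₊
  have htN : |t| < N + 1 := Nat.lt_floor_add_one _
  have hd := hα N t (abs_lt.mp htN)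
  refine hd.congr_of_eventuallyEq ?_
  filter_upwards [(continuous_abs.tendsto t).eventually (gt_mem_nhds htN)] with u hu
  exact hval N u hu

/-- A function whose derivative annihilates the vector field along an integral curve is constant
along this curve. -/
theorem eq_of_conserved {V : Type*} [NormedAddCommGroup V] [NormedSpace ℝ V] {Y : E → E}
    {F : E → V} {γ : ℝ → E} {T : ℝ}
    (hγ : IsIntegralCurveOn γ (fun _ => Y) (Icc 0 T))
    (hF : ∀ t ∈ Icc 0 T, DifferentiableAt ℝ F (γ t) ∧ fderiv ℝ F (γ t) (Y (γ t)) = 0) :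
    ∀ t ∈ Icc 0 T, F (γ t) = F (γ 0) := by
  have hd : ∀ t ∈ Icc 0 T, HasDerivWithinAt (F ∘ γ) 0 (Icc 0 T) t := by
    intro t ht
    have := (hF t ht).1.hasFDerivAt.comp_hasDerivWithinAt t (hγ t ht)
    rwa [(hF t ht).2] at this
  refine constant_of_has_deriv_right_zero (f := F ∘ γ)
    (fun t ht => (hd t ht).continuousWithinAt) fun t ht => ?_
  exact (hd t (Ico_subset_Icc_self ht)).mono_of_mem_nhdsWithin
    (mem_of_superset (Icc_mem_nhdsGE ht.2) (Icc_subset_Icc_left ht.1))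

/-- A curve that starts inside a ball and along which a conserved quantity differs from its values
on the bounding sphere stays inside the ball. -/
theorem dist_lt_of_conserved {V : Type*} [NormedAddCommGroup V] [NormedSpace ℝ V] {Y : E → E}
    {F : E → V} {x₀ : E} {γ : ℝ → E} {T ε : ℝ}
    (hγ : IsIntegralCurveOn γ (fun _ => Y) (Icc 0 T))
    (hF : ∀ x ∈ closedBall x₀ ε, DifferentiableAt ℝ F x ∧ fderiv ℝ F x (Y x) = 0)
    (h0 : dist (γ 0) x₀ < ε) (hne : ∀ y ∈ sphere x₀ ε, F y ≠ F (γ 0)) :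
    ∀ t ∈ Icc 0 T, dist (γ t) x₀ < ε := by
  by_contra! hcon
  obtain ⟨t₁, ht₁, hd₁⟩ := hcon
  have hcont : ContinuousOn (fun t => dist (γ t) x₀) (Icc 0 T) :=
    fun t ht => (hγ.continuousWithinAt ht).dist continuousWithinAt_const
  have hcl : IsCompact (Icc 0 T ∩ (fun t => dist (γ t) x₀) ⁻¹' Ici ε) :=
    isCompact_Icc.of_isClosed_subset (hcont.preimage_isClosed_of_isClosed isClosed_Icc isClosed_Ici)
      inter_subset_left
  -- At the first exit time `τ` the curve is on the sphere, while `F` is still constant up to `τ`.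
  obtain ⟨τ, ⟨hτ, hτε⟩, hmin⟩ := hcl.exists_isLeast ⟨t₁, ht₁, hd₁⟩
  have hlt : ∀ t ∈ Ico 0 τ, dist (γ t) x₀ < ε := by
    intro t ht
    by_contra! h
    exact absurd (hmin ⟨⟨ht.1, ht.2.le.trans hτ.2⟩, h⟩) (not_le.mpr ht.2)
  have hτ0 : 0 < τ := by
    rcases hτ.1.eq_or_lt with h | h
    · rw [← h] at hτε
      exact absurd h0 (not_lt.mpr hτε)
    · exact h
  have hsub : Icc 0 τ ⊆ Icc 0 T := Icc_subset_Icc_right hτ.2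
  have hle : ∀ t ∈ Icc 0 τ, dist (γ t) x₀ ≤ ε := by
    have := ContinuousWithinAt.closure_le (s := Ico 0 τ) (f := fun t => dist (γ t) x₀)
      (g := fun _ => ε) (x := τ) (by rw [closure_Ico hτ0.ne]; exact ⟨hτ0.le, le_rfl⟩)
      ((hcont τ hτ).mono (Ico_subset_Icc_self.trans hsub)) continuousWithinAt_const
      (fun t ht => (hlt t ht).le)
    intro t ht
    rcases ht.2.eq_or_lt with h | h
    · rwa [h]
    · exact (hlt t ⟨ht.1, h⟩).le
  have hconst := eq_of_conserved (F := F) (hγ.mono hsub) (fun t ht => hF _ (hle t ht)) τ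
    ⟨hτ0.le, le_rfl⟩
  exact hne (γ τ) (le_antisymm (hle τ ⟨hτ0.le, le_rfl⟩) hτε) hconst

/-- An equilibrium that is isolated in its level set of a conserved quantity is Lyapunov stable. -/
theorem lyapunovStable_of_isolated [FiniteDimensional ℝ E] {V : Type*} [NormedAddCommGroup V]
    [NormedSpace ℝ V] {X : E → E} {U : Set E} {F : E → V} {x₀ : E} (hU : IsOpen U)
    (hx₀ : x₀ ∈ U) (hX : ContDiffOn ℝ 1 X U)
    (hF : ∀ x ∈ U, DifferentiableAt ℝ F x ∧ fderiv ℝ F x (X x) = 0)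
    (hiso : ∀ᶠ x in 𝓝[≠] x₀, F x ≠ F x₀) : LyapunovStable X U x₀ := by
  have : ProperSpace E := FiniteDimensional.proper ℝ E
  have : CompleteSpace E := FiniteDimensional.complete ℝ E
  intro ε hε
  obtain ⟨ρ, hρ, hρU⟩ := Metric.nhds_basis_closedBall.mem_iff.mp
    (inter_mem (hU.mem_nhds hx₀) (eventually_nhdsWithin_iff.mp hiso))
  obtain ⟨R, hR0, hRε, hRρ⟩ : ∃ R, 0 < R ∧ R ≤ ε ∧ R < ρ :=
    ⟨min ε (ρ / 2), lt_min hε (half_pos hρ), min_le_left _ _,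
      (min_le_right _ _).trans_lt (half_lt_self hρ)⟩
  have hballU : closedBall x₀ ρ ⊆ U := fun x hx => (hρU hx).1
  have hRU : closedBall x₀ R ⊆ U := (closedBall_subset_closedBall hRρ.le).trans hballU
  have hFc : ContinuousOn F U := fun x hx => (hF x hx).1.continuousAt.continuousWithinAt
  obtain ⟨m, hm, hmle⟩ : ∃ m, 0 < m ∧ ∀ y ∈ sphere x₀ R, m ≤ ‖F y - F x₀‖ := by
    rcases (sphere x₀ R).eq_empty_or_nonempty with h | h
    · exact ⟨1, one_pos, by simp [h]⟩
    · obtain ⟨y, hy, hmin⟩ := (isCompact_sphere x₀ R).exists_isMinOn h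
        (f := fun y => ‖F y - F x₀‖)
        (((hFc.mono (sphere_subset_closedBall.trans hRU)).sub continuousOn_const).norm)
      refine ⟨_, norm_pos_iff.mpr (sub_ne_zero.mpr ?_), fun z hz => hmin hz⟩
      exact (hρU (closedBall_subset_closedBall hRρ.le (sphere_subset_closedBall hy))).2
        (ne_of_mem_sphere hy hR0.ne')
  obtain ⟨δ, hδ, hδm⟩ := Metric.mem_nhds_iff.mp
    (((hF x₀ hx₀).1.continuousAt.eventually (ball_mem_nhds _ hm)))
  refine ⟨min δ R, lt_min hδ hR0, fun x _ hxd => ?_⟩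
  have hxR : dist x x₀ < R := hxd.trans_le (min_le_right _ _)
  have hne : ∀ y ∈ sphere x₀ R, F y ≠ F x := by
    intro y hy heq
    have h1 : dist (F x) (F x₀) < m := hδm (mem_ball.mpr (hxd.trans_le (min_le_left _ _)))
    have h2 := hmle y hy
    rw [heq, ← dist_eq_norm] at h2
    exact absurd h1 (not_lt.mpr h2)
  constructor
  -- The cut-off field is complete and, being a pointwise multiple of `X`, has the same conserved
  -- quantity. Its curve is trapped in the ball of radius `R`, where it equals `X`.
  · let χ : ContDiffBump x₀ := ⟨R, ρ, hR0, hRρ⟩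
    let Y : E → E := fun y => χ y • X y
    have hYc : HasCompactSupport Y := χ.hasCompactSupport.smul_right
    have hY : ContDiff ℝ 1 Y := by
      rw [contDiff_iff_contDiffAt]
      intro y
      by_cases hy : y ∈ closedBall x₀ ρ
      · exact χ.contDiffAt.smul (hX.contDiffAt (hU.mem_nhds (hballU hy)))
      · have : Y =ᶠ[𝓝 y] fun _ => 0 := by
          filter_upwards [isClosed_closedBall.isOpen_compl.mem_nhds hy] with z hz
          have hz' : χ z = 0 := χ.zero_of_le_dist (show ρ < dist z x₀ by simpa using hz).le
          simp [Y, hz']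
        exact contDiffAt_const.congr_of_eventuallyEq this
    obtain ⟨K, hK⟩ := hY.lipschitzWith_of_hasCompactSupport hYc one_ne_zero
    obtain ⟨L, hL⟩ := hYc.exists_bound_of_continuous hY.continuous
    obtain ⟨γ, hγ0, hγ⟩ := exists_isIntegralCurve_of_lipschitzWith hK (L := L.toNNReal)
      (fun y => (hL y).trans (Real.le_coe_toNNReal L)) x
    have hstay : ∀ t ∈ Ici (0 : ℝ), dist (γ t) x₀ < R := by
      intro t ht
      refine dist_lt_of_conserved (F := F) (hγ.isIntegralCurveOn (Icc 0 t)) (fun y hy => ?_)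
        (by rwa [hγ0]) (by rwa [hγ0]) t ⟨ht, le_rfl⟩
      refine ⟨(hF y (hRU hy)).1, ?_⟩
      simp [Y, (hF y (hRU hy)).2]
    refine ⟨γ, hγ0, fun t ht => ?_, fun t ht => hRU (hstay t ht).le⟩
    have hd := (hγ t).hasDerivWithinAt (s := Ici 0)
    have h1 : χ (γ t) = 1 := χ.one_of_mem_closedBall (hstay t ht).le
    simpa [Y, h1] using hd
  · intro T γ hγ0 hγ _ t ht
    have hsub : Icc 0 t ⊆ Ico 0 T := fun u hu => ⟨hu.1, hu.2.trans_lt ht.2⟩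
    refine (dist_lt_of_conserved (F := F) (hγ.mono hsub) (fun y hy => hF y (hRU hy))
      (by rwa [hγ0]) (by rwa [hγ0]) t ⟨ht.1, le_rfl⟩).trans_le hRε

/-- Stability passes to smaller sets of initial values. -/
theorem LyapunovStable.on {X : E → E} {U : Set E} {x₀ : E} (h : LyapunovStable X U x₀)
    (hU : U ∈ 𝓝 x₀) (S : Set E) : LyapunovStableOn X U S x₀ := by
  intro ε hε
  obtain ⟨δ, hδ, h⟩ := h ε hε
  obtain ⟨ρ, hρ, hρU⟩ := Metric.mem_nhds_iff.mp hU
  exact ⟨min δ ρ, lt_min hδ hρ, fun x _ hx =>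
    h x (hρU (hx.trans_le (min_le_right _ _))) (hx.trans_le (min_le_left _ _))⟩

end ODE

/-- The second derivative test for strict minima. -/
theorem eventually_lt_of_second_deriv_pos {f f' : ℝ → ℝ} {x₀ f'' : ℝ}
    (hf : ∀ᶠ x in 𝓝 x₀, HasDerivAt f (f' x) x) (hf' : HasDerivAt f' f'' x₀) (h0 : f' x₀ = 0)
    (hpos : 0 < f'') : ∀ᶠ x in 𝓝[≠] x₀, f x₀ < f x := by
  -- Subtracting a parabola halves the second derivative but keeps it positive; a weak local minimum
  -- of `k` is then a strict one of `f`.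
  let k : ℝ → ℝ := fun x => f x - f'' / 4 * (x - x₀) ^ 2
  have hk : deriv k =ᶠ[𝓝 x₀] fun x => f' x - f'' / 2 * (x - x₀) := by
    filter_upwards [hf] with x hx
    have h := hx.sub ((((hasDerivAt_id x).sub_const x₀).pow 2).const_mul (f'' / 4))
    have h' : HasDerivAt k (f' x - f'' / 2 * (x - x₀)) x := by
      convert! h using 1
      simp
      ring
    exact h'.deriv
  have hk' : HasDerivAt (fun x => f' x - f'' / 2 * (x - x₀)) (f'' / 2) x₀ := by
    have h := hf'.sub (((hasDerivAt_id x₀).sub_const x₀).const_mul (f'' / 2))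
    convert! h using 1
    ring
  have hcont : ContinuousAt k x₀ :=
    hf.self_of_nhds.continuousAt.sub (by fun_prop)
  have hmin : IsLocalMin k x₀ := by
    refine isLocalMin_of_deriv_deriv_pos ?_ ?_ hcont
    · rw [hk.deriv_eq, hk'.deriv]
      exact half_pos hpos
    · rw [hk.eq_of_nhds, h0]
      simp
  filter_upwards [nhdsWithin_le_nhds hmin, self_mem_nhdsWithin] with x hx hne
  have h1 : k x₀ ≤ k x := hx
  have h2 : 0 < f'' / 4 * (x - x₀) ^ 2 :=
    mul_pos (by linarith) (sq_pos_of_ne_zero (sub_ne_zero.mpr hne))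
  simp only [k, sub_self] at h1
  linarith

/-! ### The profile of a level set as a function of k. -/

section LevelSets

/-- The squared distance of the vortices on an energy level through a point with squared distance
`s₀` and `(1 - μ₁) (1 - μ₂) = k₀`, as a function of `k = (1 - μ₁) (1 - μ₂)`. -/
noncomputable def levelDist (c k₀ s₀ k : ℝ) : ℝ := s₀ * (k / k₀) ^ (1 / c)

/-- The value of `4 μ₄²` on the level set `μ₁ + μ₂ = σ`, `det μ = 0` of energy as in `levelDist`, as
a function of `k = (1 - μ₁) (1 - μ₂)`. -/
noncomputable def levelProfile (c k₀ s₀ σ k : ℝ) : ℝ :=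
  4 * k - 4 + 4 * σ - (σ - levelDist c k₀ s₀ k) ^ 2

/-- The derivative of `levelProfile`. -/
noncomputable def levelProfileDeriv (c k₀ s₀ σ k : ℝ) : ℝ :=
  4 + 2 / c * ((σ - levelDist c k₀ s₀ k) * levelDist c k₀ s₀ k / k)

variable {c k₀ s₀ σ k : ℝ}

theorem levelDist_self (hk₀ : 0 < k₀) : levelDist c k₀ s₀ k₀ = s₀ := by
  simp [levelDist, div_self hk₀.ne']

theorem levelDist_pos (hk₀ : 0 < k₀) (hs₀ : 0 < s₀) (hk : 0 < k) : 0 < levelDist c k₀ s₀ k :=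
  mul_pos hs₀ (Real.rpow_pos_of_pos (div_pos hk hk₀) _)

theorem log_levelDist (hc : 0 < c) (hk₀ : 0 < k₀) (hs₀ : 0 < s₀) (hk : 0 < k) :
    c * Real.log (levelDist c k₀ s₀ k) = c * Real.log s₀ + (Real.log k - Real.log k₀) := by
  have hq := div_pos hk hk₀
  rw [levelDist, Real.log_mul hs₀.ne' (Real.rpow_pos_of_pos hq _).ne', Real.log_rpow hq,
    Real.log_div hk.ne' hk₀.ne']
  field_simp

/-- Conservation of energy says that log k - c log s is constant; solving for s gives the power law.
-/
theorem eq_levelDist_iff (hc : 0 < c) (hk₀ : 0 < k₀) (hs₀ : 0 < s₀) (hk : 0 < k) {s : ℝ}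
    (hs : 0 < s) : s = levelDist c k₀ s₀ k ↔
      Real.log k - c * Real.log s = Real.log k₀ - c * Real.log s₀ := by
  have h := log_levelDist hc hk₀ hs₀ hk
  constructor
  · rintro rfl
    linarith
  · intro heq
    refine Real.log_injOn_pos hs (levelDist_pos hk₀ hs₀ hk) ?_
    exact mul_left_cancel₀ hc.ne' (by linarith)

theorem hasDerivAt_levelDist (hk₀ : 0 < k₀) (hk : 0 < k) :
    HasDerivAt (levelDist c k₀ s₀) (levelDist c k₀ s₀ k / (c * k)) k := by
  have hq := div_pos hk hk₀
  have h := (((hasDerivAt_id k).div_const k₀).rpow_const (p := 1 / c) (Or.inl hq.ne')).const_mul s₀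
  convert! h using 1
  simp only [id, levelDist, Real.rpow_sub_one hq.ne']
  field_simp

theorem hasDerivAt_levelProfile (hk₀ : 0 < k₀) (hk : 0 < k) :
    HasDerivAt (levelProfile c k₀ s₀ σ) (levelProfileDeriv c k₀ s₀ σ k) k := by
  have hS := hasDerivAt_levelDist (c := c) (s₀ := s₀) hk₀ hk
  have h := ((((hasDerivAt_id k).const_mul 4).sub_const 4).add_const (4 * σ)).sub
    ((hS.const_sub σ).pow 2)
  convert! h using 1
  simp only [levelProfileDeriv, Nat.cast_ofNat, Nat.add_one_sub_one, pow_one, mul_one]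
  rw [← div_div]
  ring

theorem hasDerivAt_levelProfileDeriv (hk₀ : 0 < k₀) (hc : 0 < c) :
    HasDerivAt (levelProfileDeriv c k₀ s₀ σ)
      (2 * s₀ / (c ^ 2 * k₀ ^ 2) * ((σ - 2 * s₀) - c * (σ - s₀))) k₀ := by
  have hS := hasDerivAt_levelDist (c := c) (s₀ := s₀) hk₀ hk₀
  have h := ((((hS.const_sub σ).mul hS).div (hasDerivAt_id k₀) hk₀.ne').const_mul
    (2 / c)).const_add 4
  convert! h using 1
  simp only [levelDist_self hk₀, id, Pi.mul_apply]
  field_simp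
  ring

theorem levelProfileDeriv_self (hk₀ : 0 < k₀) :
    levelProfileDeriv c k₀ s₀ σ k₀ = 4 + 2 / c * ((σ - s₀) * s₀ / k₀) := by
  rw [levelProfileDeriv, levelDist_self hk₀]

/-- This first-order test and the next serve equilibria A, where k approaches k₀ only from below.
The two second-order tests after them serve equilibria B. -/
theorem eventually_levelProfile_neg_left (hk₀ : 0 < k₀) (h0 : levelProfile c k₀ s₀ σ k₀ = 0)
    (h : 0 < levelProfileDeriv c k₀ s₀ σ k₀) :
    ∀ᶠ k in 𝓝[<] k₀, levelProfile c k₀ s₀ σ k < 0 := by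
  have hd := hasDerivAt_levelProfile (c := c) (s₀ := s₀) (σ := σ) hk₀ hk₀
  have := eventually_nhdsWithin_sign_eq_of_deriv_pos (by rwa [hd.deriv]) h0
  filter_upwards [nhdsWithin_le_nhds this, self_mem_nhdsWithin] with k hk (hlt : k < k₀)
  rwa [sign_neg (sub_neg.mpr hlt), sign_eq_neg_one_iff] at hk

theorem eventually_levelProfile_pos_left (hk₀ : 0 < k₀) (h0 : levelProfile c k₀ s₀ σ k₀ = 0)
    (h : levelProfileDeriv c k₀ s₀ σ k₀ < 0) :
    ∀ᶠ k in 𝓝[<] k₀, 0 < levelProfile c k₀ s₀ σ k := by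
  have hd := hasDerivAt_levelProfile (c := c) (s₀ := s₀) (σ := σ) hk₀ hk₀
  have := eventually_nhdsWithin_sign_eq_of_deriv_neg (by rwa [hd.deriv]) h0
  filter_upwards [nhdsWithin_le_nhds this, self_mem_nhdsWithin] with k hk (hlt : k < k₀)
  rwa [sign_pos (sub_pos.mpr hlt), sign_eq_one_iff] at hk

theorem eventually_levelProfile_neg (hk₀ : 0 < k₀) (hc : 0 < c) (hs₀ : 0 < s₀)
    (h0 : levelProfile c k₀ s₀ σ k₀ = 0) (h1 : levelProfileDeriv c k₀ s₀ σ k₀ = 0)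
    (h : (σ - 2 * s₀) - c * (σ - s₀) < 0) :
    ∀ᶠ k in 𝓝[≠] k₀, levelProfile c k₀ s₀ σ k < 0 := by
  have := eventually_lt_of_second_deriv_pos
    (f := fun k => -levelProfile c k₀ s₀ σ k) (f' := fun k => -levelProfileDeriv c k₀ s₀ σ k)
    ((eventually_gt_nhds hk₀).mono fun k hk => (hasDerivAt_levelProfile hk₀ hk).neg)
    (hasDerivAt_levelProfileDeriv hk₀ hc).neg (by rw [h1, neg_zero])
    (neg_pos.mpr (mul_neg_of_pos_of_neg (by positivity) h))
  simpa [h0] using this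

theorem eventually_levelProfile_pos (hk₀ : 0 < k₀) (hc : 0 < c) (hs₀ : 0 < s₀)
    (h0 : levelProfile c k₀ s₀ σ k₀ = 0) (h1 : levelProfileDeriv c k₀ s₀ σ k₀ = 0)
    (h : 0 < (σ - 2 * s₀) - c * (σ - s₀)) :
    ∀ᶠ k in 𝓝[≠] k₀, 0 < levelProfile c k₀ s₀ σ k := by
  have := eventually_lt_of_second_deriv_pos
    ((eventually_gt_nhds hk₀).mono fun k hk => hasDerivAt_levelProfile (σ := σ) hk₀ hk)
    (hasDerivAt_levelProfileDeriv hk₀ hc) h1 (mul_pos (by positivity) h)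
  simpa [h0] using this

end LevelSets

/-! ### The vector field and its integrals of motion. -/

section Field

theorem isOpen_domain : IsOpen domain := by
  have h : domain = {μ : Shape | μ 0 < 1} ∩ ({μ | μ 1 < 1} ∩ {μ | 0 < μ 0 + μ 1 - 2 * μ 2}) := rfl
  rw [h]
  exact (isOpen_lt (by fun_prop) (by fun_prop)).inter
    ((isOpen_lt (by fun_prop) (by fun_prop)).inter (isOpen_lt (by fun_prop) (by fun_prop)))

variable {c : ℝ} {Γ : Fin 2 → ℝ} {μ : Shape}

theorem hasFDerivAt_coord (i : Fin 4) (μ : Shape) :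
    HasFDerivAt (fun μ : Shape => μ i) (EuclideanSpace.proj i : Shape →L[ℝ] ℝ) μ :=
  (EuclideanSpace.proj i : Shape →L[ℝ] ℝ).hasFDerivAt

/-- The differential of the Hamiltonian. -/
theorem hasFDerivAt_ham (hμ : μ ∈ domain) :
    HasFDerivAt (ham c Γ)
      ((2⁻¹ : ℝ) • ((Γ 0 ^ 2) • (1 - μ 0)⁻¹ • (-(EuclideanSpace.proj 0 : Shape →L[ℝ] ℝ))
        + (Γ 1 ^ 2) • (1 - μ 1)⁻¹ • (-(EuclideanSpace.proj 1 : Shape →L[ℝ] ℝ))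
        - (c * Γ 0 * Γ 1) • (μ 0 + μ 1 - 2 * μ 2)⁻¹ •
          ((EuclideanSpace.proj 0 : Shape →L[ℝ] ℝ) + (EuclideanSpace.proj 1 : Shape →L[ℝ] ℝ)
            - (2 : ℝ) • (EuclideanSpace.proj 2 : Shape →L[ℝ] ℝ)))) μ := by
  obtain ⟨h0, h1, h2⟩ := hμ
  have e0 := (((hasFDerivAt_coord 0 μ).const_sub 1).log (sub_pos.mpr h0).ne').const_mul (Γ 0 ^ 2)
  have e1 := (((hasFDerivAt_coord 1 μ).const_sub 1).log (sub_pos.mpr h1).ne').const_mul (Γ 1 ^ 2)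
  have e2 := ((((hasFDerivAt_coord 0 μ).add (hasFDerivAt_coord 1 μ)).sub
    ((hasFDerivAt_coord 2 μ).const_mul 2)).log h2.ne').const_mul (c * Γ 0 * Γ 1)
  have := ((e0.add e1).sub e2).const_mul (2⁻¹ : ℝ)
  refine this.congr_of_eventuallyEq (Eventually.of_forall fun ν => ?_)
  simp only [ham, Pi.add_apply, Pi.sub_apply]
  ring

/-- The Lie-Poisson field of two vortices of equal charge in coordinates. -/
theorem lpField_eq (hΓ : Γ 0 = Γ 1) (hΓ0 : Γ 0 ≠ 0) (hμ : μ ∈ domain) :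
    lpField c Γ μ =
      !₂[2 * Γ 0 * c * μ 3 / (μ 0 + μ 1 - 2 * μ 2), -(2 * Γ 0 * c * μ 3 / (μ 0 + μ 1 - 2 * μ 2)),
        Γ 0 * (μ 0 - μ 1) * μ 3 / ((1 - μ 0) * (1 - μ 1)),
        -(Γ 0 * (μ 0 - μ 1) * (c / (μ 0 + μ 1 - 2 * μ 2) + μ 2 / ((1 - μ 0) * (1 - μ 1))))] := by
  have hpd : ∀ i, pd (ham c Γ) i μ = _ := fun i =>
    ((hasFDerivAt_ham (c := c) (Γ := Γ) hμ).hasLineDerivAt (EuclideanSpace.single i 1)).lineDeriv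
  have p0 := hpd 0
  have p1 := hpd 1
  have p2 := hpd 2
  have p3 := hpd 3
  obtain ⟨h0, h1, h2⟩ := hμ
  have h0' : 1 - μ 0 ≠ 0 := (sub_pos.mpr h0).ne'
  have h1' : 1 - μ 1 ≠ 0 := (sub_pos.mpr h1).ne'
  simp [← hΓ] at p0 p1 p2 p3
  -- Equal charges: D⁻¹ is scalar and the field becomes a commutator.
  have hci : chargeInv Γ = ((Γ 0)⁻¹ : ℂ) • (1 : Matrix (Fin 2) (Fin 2) ℂ) := by
    ext i j
    fin_cases i <;> fin_cases j <;> simp [chargeInv, ← hΓ]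
  have hs := h2.ne'
  rw [lpField, varDeriv, hci, p3]
  generalize pd (ham c Γ) 0 μ = a₀ at *
  generalize pd (ham c Γ) 1 μ = a₁ at *
  generalize pd (ham c Γ) 2 μ = a₂ at *
  generalize μ 0 + μ 1 - 2 * μ 2 = s at *
  ext i
  fin_cases i <;> simp [coords, toMat]
  all_goals
    subst p0 p1 p2
    field_simp
    ring

/-- The integrals of motion `μ₁ + μ₂`, `det μ` and the energy. -/
noncomputable def integrals (c : ℝ) (μ : Shape) : ℝ × ℝ × ℝ :=
  (μ 0 + μ 1, μ 0 * μ 1 - μ 2 ^ 2 - μ 3 ^ 2,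
    Real.log (1 - μ 0) + Real.log (1 - μ 1) - c * Real.log (μ 0 + μ 1 - 2 * μ 2))

/-- A commutator with μ preserves trace and determinant; the third component is h up to the factor
Γ² / 2. The proof checks all three in coordinates. -/
theorem integrals_conserved (hΓ : Γ 0 = Γ 1) (hΓ0 : Γ 0 ≠ 0) (hμ : μ ∈ domain) :
    DifferentiableAt ℝ (integrals c) μ ∧
      fderiv ℝ (integrals c) μ (lpField c Γ μ) = 0 := by
  have hX := lpField_eq (c := c) hΓ hΓ0 hμ
  obtain ⟨h0, h1, h2⟩ := hμ
  have h0' := (sub_pos.mpr h0).ne'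
  have h1' := (sub_pos.mpr h1).ne'
  have h2' := h2.ne'
  have p := fun i => hasFDerivAt_coord i μ
  have d := ((p 0).add (p 1)).prodMk (((((p 0).mul (p 1)).sub ((p 2).pow 2)).sub
    ((p 3).pow 2)).prodMk (((((p 0).const_sub 1).log h0').add (((p 1).const_sub 1).log h1')).sub
    (((((p 0).add (p 1)).sub ((p 2).const_mul 2)).log h2').const_mul c)))
  have d' : HasFDerivAt (integrals c) _ μ := d
  refine ⟨d'.differentiableAt, ?_⟩
  rw [d'.fderiv, hX]
  ext
  · simp
  · simp
    field_simp
    ring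
  · simp
    field_simp
    ring

theorem contDiffOn_lpField (hΓ : Γ 0 = Γ 1) (hΓ0 : Γ 0 ≠ 0) :
    ContDiffOn ℝ 1 (lpField c Γ) domain := by
  refine ContDiffOn.congr ?_ fun μ hμ => lpField_eq (c := c) hΓ hΓ0 hμ
  have hs : ∀ μ ∈ domain, μ 0 + μ 1 - 2 * μ 2 ≠ 0 := fun μ hμ => hμ.2.2.ne'
  have hk : ∀ μ ∈ domain, (1 - μ 0) * (1 - μ 1) ≠ 0 := fun μ hμ =>
    (mul_pos (sub_pos.mpr hμ.1) (sub_pos.mpr hμ.2.1)).ne'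
  have hp : ∀ i, ContDiffOn ℝ 1 (fun μ : Shape => μ i) domain := fun i =>
    (EuclideanSpace.proj i : Shape →L[ℝ] ℝ).contDiff.contDiffOn
  have hsd : ContDiffOn ℝ 1 (fun μ : Shape => μ 0 + μ 1 - 2 * μ 2) domain :=
    ((hp 0).add (hp 1)).sub (contDiffOn_const.mul (hp 2))
  have hkd : ContDiffOn ℝ 1 (fun μ : Shape => (1 - μ 0) * (1 - μ 1)) domain :=
    (contDiffOn_const.sub (hp 0)).mul (contDiffOn_const.sub (hp 1))
  have e0 := (contDiffOn_const (c := 2 * Γ 0 * c)).mul (hp 3) |>.div hsd hs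
  have hd := (contDiffOn_const (c := Γ 0)).mul ((hp 0).sub (hp 1))
  rw [contDiffOn_euclidean]
  intro i
  fin_cases i
  · exact e0
  · exact e0.neg
  · exact (hd.mul (hp 3)).div hkd hk
  · exact (hd.mul ((contDiffOn_const.div hsd hs).add ((hp 2).div hkd hk))).neg

theorem dumbbell_mem_domain {r₁ r₂ : ℝ} (hr₁ : 0 ≤ r₁) (hr₁' : r₁ < 1) (hr₂ : 0 ≤ r₂)
    (hr₂' : r₂ < 1) (hr : 0 < r₁ + r₂) : dumbbell r₁ r₂ ∈ domain := by
  refine ⟨?_, ?_, ?_⟩ <;> simp only [dumbbell] <;> simp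
  · rwa [abs_of_nonneg hr₁]
  · rwa [abs_of_nonneg hr₂]
  · nlinarith

/-- A shape of rank one with `μ₁ > 0` is the shape of a configuration. -/
theorem mem_range_shapeOf (h0 : 0 < μ 0) (h : μ 0 * μ 1 = μ 2 ^ 2 + μ 3 ^ 2) :
    μ ∈ range shapeOf := by
  have hs := Real.sqrt_pos.mpr h0
  have hsq := Real.mul_self_sqrt h0.le
  -- Rotating the configuration makes the first vortex real and positive; the off-diagonal entry
  -- then determines the second.
  refine ⟨![(√(μ 0) : ℂ), ⟨μ 2 / √(μ 0), -(μ 3 / √(μ 0))⟩], ?_⟩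
  ext i
  fin_cases i <;> simp [shapeOf, coords, Matrix.vecMulVec_apply, -Matrix.cons_vecMulVec]
  · exact hsq
  · field_simp
    rw [Real.sq_sqrt h0.le]
    linarith
  · field_simp
  · field_simp

end Field

/-! ### The escape argument. -/

/-- A function on the half-line with `d' = w q`, `w² = P ∘ d`, where `q` is bounded below and `P` is
positive, cannot stay bounded above when `w` is positive initially. -/
theorem not_bounded_of_sq_eq {d w q P : ℝ → ℝ} {d₁ q₀ : ℝ} (hd : ContinuousOn d (Ici 0))
    (hw : ContinuousOn w (Ici 0)) (hderiv : ∀ t > 0, HasDerivAt d (w t * q t) t) (hq₀ : 0 < q₀)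
    (hq : ∀ t > 0, q₀ ≤ q t) (hP : ContinuousOn P (Icc (d 0) d₁))
    (hPpos : ∀ x ∈ Icc (d 0) d₁, 0 < P x) (hle : ∀ t ≥ 0, d t ≤ d₁)
    (hwP : ∀ t ≥ 0, w t ^ 2 = P (d t)) (hw0 : 0 < w 0) : False := by
  -- Up to its first zero `w` is positive, so `d` has only increased and `P` is still positive
  -- there, contradicting `w ^ 2 = P ∘ d`.
  have hwpos : ∀ t ≥ 0, 0 < w t := by
    by_contra! hcon
    obtain ⟨t₁, ht₁, hwt₁⟩ := hcon
    have hcl : IsCompact (Icc 0 t₁ ∩ w ⁻¹' Iic 0) :=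
      isCompact_Icc.of_isClosed_subset
        ((hw.mono Icc_subset_Ici_self).preimage_isClosed_of_isClosed isClosed_Icc isClosed_Iic)
        inter_subset_left
    obtain ⟨τ, ⟨hτ, hτw⟩, hmin⟩ := hcl.exists_isLeast ⟨t₁, ⟨ht₁, le_rfl⟩, hwt₁⟩
    have hlt : ∀ t ∈ Ico 0 τ, 0 < w t := by
      intro t ht
      by_contra! h
      exact absurd (hmin ⟨⟨ht.1, ht.2.le.trans hτ.2⟩, h⟩) (not_le.mpr ht.2)
    have hτ0 : 0 < τ := by
      rcases hτ.1.eq_or_lt with h | h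
      · rw [← h] at hτw
        exact absurd hw0 (not_lt.mpr hτw)
      · exact h
    have hwτ : 0 ≤ w τ :=
      ContinuousWithinAt.closure_le (s := Ico 0 τ) (f := fun _ => (0 : ℝ))
        (by rw [closure_Ico hτ0.ne]; exact ⟨hτ0.le, le_rfl⟩) continuousWithinAt_const
        ((hw τ hτ.1).mono (Ico_subset_Icc_self.trans Icc_subset_Ici_self))
        (fun t ht => (hlt t ht).le)
    have hmono : MonotoneOn d (Icc 0 τ) := by
      refine monotoneOn_of_deriv_nonneg (convex_Icc 0 τ) (hd.mono Icc_subset_Ici_self) ?_ ?_ <;>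
        rw [interior_Icc]
      · exact fun t ht => (hderiv t ht.1).differentiableAt.differentiableWithinAt
      · intro t ht
        rw [(hderiv t ht.1).deriv]
        exact mul_nonneg (hlt t ⟨ht.1.le, ht.2⟩).le (hq₀.le.trans (hq t ht.1))
    have h1 := hPpos (d τ) ⟨hmono ⟨le_rfl, hτ0.le⟩ ⟨hτ0.le, le_rfl⟩ hτ0.le, hle τ hτ0.le⟩
    rw [← hwP τ hτ0.le, le_antisymm hτw hwτ] at h1
    simp at h1
  have hmono : MonotoneOn d (Ici 0) := by
    refine monotoneOn_of_deriv_nonneg (convex_Ici 0) hd ?_ ?_ <;> rw [interior_Ici]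
    · exact fun t ht => (hderiv t ht).differentiableAt.differentiableWithinAt
    · intro t ht
      rw [(hderiv t ht).deriv]
      exact mul_nonneg (hwpos t (mem_Ioi.mp ht).le).le (hq₀.le.trans (hq t ht))
  have hmem : ∀ t ≥ 0, d t ∈ Icc (d 0) d₁ := fun t ht =>
    ⟨hmono self_mem_Ici ht ht, hle t ht⟩
  obtain ⟨y, hy, hymin⟩ := isCompact_Icc.exists_isMinOn ⟨d 0, hmem 0 le_rfl⟩ hP
  have hm := Real.sqrt_pos.mpr (hPpos y hy)
  have hwm : ∀ t ≥ 0, √(P y) ≤ w t := fun t ht =>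
    (Real.sqrt_le_left (hwpos t ht).le).mpr (by rw [hwP t ht]; exact hymin (hmem t ht))
  have hv : 0 < √(P y) * q₀ := mul_pos hm hq₀
  have hgrow := (convex_Ici (0 : ℝ)).mul_sub_le_image_sub_of_le_deriv (C := √(P y) * q₀) hd
    (by
      rw [interior_Ici]
      exact fun t ht => (hderiv t ht).differentiableAt.differentiableWithinAt)
    (by
      rw [interior_Ici]
      intro t ht
      rw [(hderiv t ht).deriv]
      exact mul_le_mul (hwm t (mem_Ioi.mp ht).le) (hq t ht) hq₀.le (hwpos t (mem_Ioi.mp ht).le).le)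
  have hd1 := (hmem 0 le_rfl).2
  -- By this time the linear lower bound puts `d` at least 1 above `d₁`.
  have hT : 0 ≤ (d₁ - d 0 + 1) / (√(P y) * q₀) := div_nonneg (by linarith) hv.le
  have := hgrow 0 self_mem_Ici _ hT hT
  rw [sub_zero, mul_div_cancel₀ _ hv.ne'] at this
  linarith [hle _ hT]

/-! ### Level sets through a dumbbell, stability and instability. -/

/-- `(1 - μ₁) (1 - μ₂)` as a function of `d = μ₁ - μ₂` where `μ₁ + μ₂ = σ`. -/
noncomputable def complProd (σ d : ℝ) : ℝ := (1 - σ / 2) ^ 2 - d ^ 2 / 4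

/-- The value of `4 μ₄²` on the level set of the integrals through a dumbbell, as a function of
`μ₁ - μ₂`. -/
noncomputable def dumbbellProfile (c r₁ r₂ d : ℝ) : ℝ :=
  levelProfile c ((1 - r₁ ^ 2) * (1 - r₂ ^ 2)) ((r₁ + r₂) ^ 2) (r₁ ^ 2 + r₂ ^ 2)
    (complProd (r₁ ^ 2 + r₂ ^ 2) d)

/-- The squared distance of the vortices on the level set of the integrals through a dumbbell, as a
function of `μ₁ - μ₂`. -/
noncomputable def dumbbellDist (c r₁ r₂ d : ℝ) : ℝ :=
  levelDist c ((1 - r₁ ^ 2) * (1 - r₂ ^ 2)) ((r₁ + r₂) ^ 2) (complProd (r₁ ^ 2 + r₂ ^ 2) d)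

variable {c r₁ r₂ : ℝ} {Γ : Fin 2 → ℝ} {μ : Shape}

theorem continuous_complProd (σ : ℝ) : Continuous (complProd σ) := by
  unfold complProd
  fun_prop

theorem complProd_dumbbell (r₁ r₂ : ℝ) :
    complProd (r₁ ^ 2 + r₂ ^ 2) (r₁ ^ 2 - r₂ ^ 2) = (1 - r₁ ^ 2) * (1 - r₂ ^ 2) := by
  unfold complProd
  ring

theorem continuous_dumbbellDist (hc : 0 < c) : Continuous (dumbbellDist c r₁ r₂) :=
  continuous_const.mul ((Real.continuous_rpow_const (one_div_pos.mpr hc).le).comp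
    ((continuous_complProd _).div_const _))

theorem dumbbellProfile_eq (c r₁ r₂ d : ℝ) : dumbbellProfile c r₁ r₂ d =
    4 * complProd (r₁ ^ 2 + r₂ ^ 2) d - 4 + 4 * (r₁ ^ 2 + r₂ ^ 2)
      - (r₁ ^ 2 + r₂ ^ 2 - dumbbellDist c r₁ r₂ d) ^ 2 := rfl

theorem continuous_dumbbellProfile (hc : 0 < c) : Continuous (dumbbellProfile c r₁ r₂) := by
  have h1 := continuous_dumbbellDist (r₁ := r₁) (r₂ := r₂) hc
  have h2 := continuous_complProd (r₁ ^ 2 + r₂ ^ 2)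
  have : dumbbellProfile c r₁ r₂ = _ := funext (dumbbellProfile_eq c r₁ r₂)
  rw [this]
  fun_prop

theorem one_sub_sq_pos {r : ℝ} (hr : 0 ≤ r) (hr' : r < 1) : 0 < 1 - r ^ 2 := by
  nlinarith

theorem dumbbellDist_self (hr₁ : 0 ≤ r₁) (hr₁' : r₁ < 1) (hr₂ : 0 ≤ r₂) (hr₂' : r₂ < 1) :
    dumbbellDist c r₁ r₂ (r₁ ^ 2 - r₂ ^ 2) = (r₁ + r₂) ^ 2 := by
  rw [dumbbellDist, complProd_dumbbell,
    levelDist_self (mul_pos (one_sub_sq_pos hr₁ hr₁') (one_sub_sq_pos hr₂ hr₂'))]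

theorem levelProfile_dumbbell (hr₁ : 0 ≤ r₁) (hr₁' : r₁ < 1) (hr₂ : 0 ≤ r₂) (hr₂' : r₂ < 1) :
    levelProfile c ((1 - r₁ ^ 2) * (1 - r₂ ^ 2)) ((r₁ + r₂) ^ 2) (r₁ ^ 2 + r₂ ^ 2)
      ((1 - r₁ ^ 2) * (1 - r₂ ^ 2)) = 0 := by
  rw [levelProfile,
    levelDist_self (mul_pos (one_sub_sq_pos hr₁ hr₁') (one_sub_sq_pos hr₂ hr₂'))]
  ring

theorem dumbbellProfile_self (hr₁ : 0 ≤ r₁) (hr₁' : r₁ < 1) (hr₂ : 0 ≤ r₂) (hr₂' : r₂ < 1) :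
    dumbbellProfile c r₁ r₂ (r₁ ^ 2 - r₂ ^ 2) = 0 := by
  rw [dumbbellProfile, complProd_dumbbell]
  exact (levelProfile_dumbbell hr₁ hr₁' hr₂ hr₂').trans rfl

/-- The level set of the integrals of motion through a dumbbell. -/
theorem integrals_eq_dumbbell_iff (hc : 0 < c) (hr₁ : 0 ≤ r₁) (hr₁' : r₁ < 1)
    (hr₂ : 0 ≤ r₂) (hr₂' : r₂ < 1) (hr : 0 < r₁ + r₂)
    (hμ : μ ∈ domain) :
    integrals c μ = integrals c (dumbbell r₁ r₂) ↔
      μ 0 + μ 1 = r₁ ^ 2 + r₂ ^ 2 ∧ μ 0 + μ 1 - 2 * μ 2 = dumbbellDist c r₁ r₂ (μ 0 - μ 1) ∧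
        4 * μ 3 ^ 2 = dumbbellProfile c r₁ r₂ (μ 0 - μ 1) := by
  obtain ⟨h0, h1, h2⟩ := hμ
  have h0' := sub_pos.mpr h0
  have h1' := sub_pos.mpr h1
  have k1 := one_sub_sq_pos hr₁ hr₁'
  have k2 := one_sub_sq_pos hr₂ hr₂'
  have hs : (0 : ℝ) < (r₁ + r₂) ^ 2 := by positivity
  have hD : integrals c (dumbbell r₁ r₂) = (r₁ ^ 2 + r₂ ^ 2, 0,
      Real.log (1 - r₁ ^ 2) + Real.log (1 - r₂ ^ 2) - c * Real.log ((r₁ + r₂) ^ 2)) := by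
    simp only [integrals, dumbbell]
    simp
    constructor
    · ring
    · left
      rw [show r₁ ^ 2 + r₂ ^ 2 + 2 * (r₁ * r₂) = (r₁ + r₂) ^ 2 by ring, Real.log_pow,
        Nat.cast_ofNat]
  rw [hD, integrals, Prod.mk.injEq, Prod.mk.injEq]
  refine and_congr_right fun hσ => ?_
  have hk : complProd (r₁ ^ 2 + r₂ ^ 2) (μ 0 - μ 1) = (1 - μ 0) * (1 - μ 1) := by
    rw [← hσ, complProd]
    ring
  rw [← Real.log_mul h0'.ne' h1'.ne', ← Real.log_mul k1.ne' k2.ne',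
    ← eq_levelDist_iff hc (mul_pos k1 k2) hs (mul_pos h0' h1') h2, ← hk, and_comm]
  refine and_congr_right fun hS => ?_
  rw [← dumbbellDist] at hS
  rw [dumbbellProfile_eq, ← hS, hk, ← hσ]
  constructor <;> intro h <;> linarith

theorem lyapunovStable_dumbbell (hc : 0 < c) (hr₁ : 0 ≤ r₁) (hr₁' : r₁ < 1)
    (hr₂ : 0 ≤ r₂) (hr₂' : r₂ < 1) (hr : 0 < r₁ + r₂)
    (hΓ : Γ 0 = Γ 1) (hΓ0 : Γ 0 ≠ 0)
    (h : ∀ᶠ d in 𝓝[≠] (r₁ ^ 2 - r₂ ^ 2), dumbbellProfile c r₁ r₂ d < 0) :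
    LyapunovStable (lpField c Γ) domain (dumbbell r₁ r₂) := by
  have hmem := dumbbell_mem_domain hr₁ hr₁' hr₂ hr₂' hr
  refine lyapunovStable_of_isolated (F := integrals c) isOpen_domain hmem
    (contDiffOn_lpField hΓ hΓ0) (fun μ hμ => integrals_conserved hΓ hΓ0 hμ) ?_
  have hcont : Continuous fun μ : Shape => μ 0 - μ 1 := by fun_prop
  have hd0 : dumbbell r₁ r₂ 0 - dumbbell r₁ r₂ 1 = r₁ ^ 2 - r₂ ^ 2 := by simp [dumbbell]
  have hev := (hcont.tendsto (dumbbell r₁ r₂)).eventually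
    (by rw [hd0]; exact eventually_nhdsWithin_iff.mp h)
  filter_upwards [nhdsWithin_le_nhds hev, nhdsWithin_le_nhds (isOpen_domain.mem_nhds hmem),
    self_mem_nhdsWithin] with μ hμ hμd hne heq
  obtain ⟨hσ, hS, hw⟩ := (integrals_eq_dumbbell_iff hc hr₁ hr₁' hr₂ hr₂' hr hμd).mp heq
  -- Otherwise the profile, which equals 4μ₄² ≥ 0, would be negative.
  have hd : μ 0 - μ 1 = r₁ ^ 2 - r₂ ^ 2 := by
    by_contra hcon
    nlinarith [hμ hcon]
  rw [hd, dumbbellDist_self hr₁ hr₁' hr₂ hr₂'] at hS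
  rw [hd, dumbbellProfile_self hr₁ hr₁' hr₂ hr₂'] at hw
  apply hne
  ext i
  fin_cases i <;> simp [dumbbell]
  · linarith
  · linarith
  · linarith
  · nlinarith

/-- The point of the level set of the integrals through a dumbbell with given `μ₁ - μ₂`. -/
noncomputable def levelPoint (c r₁ r₂ θ d : ℝ) : Shape :=
  !₂[(r₁ ^ 2 + r₂ ^ 2 + d) / 2, (r₁ ^ 2 + r₂ ^ 2 - d) / 2,
    (r₁ ^ 2 + r₂ ^ 2 - dumbbellDist c r₁ r₂ d) / 2, θ * √(dumbbellProfile c r₁ r₂ d) / 2]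

theorem continuous_levelPoint (hc : 0 < c) (θ : ℝ) : Continuous (levelPoint c r₁ r₂ θ) := by
  have h1 := continuous_dumbbellDist (r₁ := r₁) (r₂ := r₂) hc
  have h2 := continuous_dumbbellProfile (r₁ := r₁) (r₂ := r₂) hc
  refine (PiLp.continuous_toLp 2 _).comp (continuous_pi fun i => ?_)
  fin_cases i <;> simp <;> fun_prop

theorem levelPoint_self (hr₁ : 0 ≤ r₁) (hr₁' : r₁ < 1) (hr₂ : 0 ≤ r₂) (hr₂' : r₂ < 1) (θ : ℝ) :
    levelPoint c r₁ r₂ θ (r₁ ^ 2 - r₂ ^ 2) = dumbbell r₁ r₂ := by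
  rw [levelPoint, dumbbellDist_self hr₁ hr₁' hr₂ hr₂', dumbbellProfile_self hr₁ hr₁' hr₂ hr₂']
  ext i
  fin_cases i <;> simp [dumbbell]
  all_goals ring

theorem abs_coord_sub_le (μ ν : Shape) (i : Fin 4) : |μ i - ν i| ≤ dist μ ν := by
  rw [dist_eq_norm]
  exact PiLp.norm_apply_le (μ - ν) i

theorem not_lyapunovStableOn_dumbbell (hc : 0 < c) (hr₁' : r₁ < 1) (hr₂ : 0 ≤ r₂) (hr₂' : r₂ < 1)
    (hr₁ : 0 < r₁) (hΓ : Γ 0 = Γ 1) (hΓ0 : Γ 0 ≠ 0)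
    (h : ∀ᶠ d in 𝓝[>] (r₁ ^ 2 - r₂ ^ 2), 0 < dumbbellProfile c r₁ r₂ d) :
    ¬ LyapunovStableOn (lpField c Γ) domain (range shapeOf) (dumbbell r₁ r₂) := by
  intro hstab
  have hr : 0 < r₁ + r₂ := by linarith
  have hmem := dumbbell_mem_domain hr₁.le hr₁' hr₂ hr₂' hr
  set d₀ := r₁ ^ 2 - r₂ ^ 2
  obtain ⟨d₂, hd₂, hpos⟩ := mem_nhdsGT_iff_exists_Ioo_subset.mp h
  have hd₂' : d₀ < d₂ := hd₂
  -- Each of μ₁, μ₂ moves by less than a quarter of the gap, so their difference stays below the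
  -- midpoint of `d₀` and `d₂`, where the profile is still positive.
  obtain ⟨δ, hδ, hstab⟩ := hstab ((d₂ - d₀) / 4) (by linarith)
  -- The sign of Γ, chosen so that Γμ₄ > 0 initially and μ₁ - μ₂ starts to grow.
  set θ := Γ 0 / |Γ 0|
  have hθ : θ ^ 2 = 1 := by
    rw [div_pow, sq_abs, div_self (pow_ne_zero 2 hΓ0)]
  have hθΓ : Γ 0 * θ = |Γ 0| := by
    rw [mul_div_assoc', div_eq_iff (abs_ne_zero.mpr hΓ0), abs_mul_abs_self]
  have hpt := (continuous_levelPoint (r₁ := r₁) (r₂ := r₂) hc θ).tendsto d₀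
  rw [levelPoint_self hr₁.le hr₁' hr₂ hr₂'] at hpt
  have hpos0 : 0 < dumbbell r₁ r₂ 0 := by
    simp only [dumbbell]
    simp
    positivity
  have hposn : {μ : Shape | 0 < μ 0} ∈ 𝓝 (dumbbell r₁ r₂) :=
    (isOpen_lt continuous_const (by fun_prop)).mem_nhds hpos0
  have hev := hpt.eventually ((eventually_mem_set.mpr (ball_mem_nhds _ hδ)).and
    ((eventually_mem_set.mpr (isOpen_domain.mem_nhds hmem)).and (eventually_mem_set.mpr hposn)))
  obtain ⟨d₁, ⟨hδ₁, hdom₁, hpos₁⟩, hd₁⟩ := ((hev.filter_mono (nhdsWithin_le_nhds (s := Ioi d₀))).and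
    (eventually_mem_set.mpr (Ioo_mem_nhdsGT hd₂'))).exists
  have hP₁ : 0 < dumbbellProfile c r₁ r₂ d₁ := hpos hd₁
  set x := levelPoint c r₁ r₂ θ d₁
  have x0 : x 0 = (r₁ ^ 2 + r₂ ^ 2 + d₁) / 2 := rfl
  have x1 : x 1 = (r₁ ^ 2 + r₂ ^ 2 - d₁) / 2 := rfl
  have x2 : x 2 = (r₁ ^ 2 + r₂ ^ 2 - dumbbellDist c r₁ r₂ d₁) / 2 := rfl
  have x3 : x 3 = θ * √(dumbbellProfile c r₁ r₂ d₁) / 2 := rfl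
  have xd : x 0 - x 1 = d₁ := by rw [x0, x1]; ring
  have x3sq : 4 * x 3 ^ 2 = dumbbellProfile c r₁ r₂ d₁ := by
    rw [x3, div_pow, mul_pow, hθ, Real.sq_sqrt hP₁.le]
    ring
  have hxS : x ∈ range shapeOf := by
    refine mem_range_shapeOf hpos₁ ?_
    have := dumbbellProfile_eq c r₁ r₂ d₁
    rw [← x3sq] at this
    rw [x0, x1, x2]
    unfold complProd at this
    linarith
  have hlevel := integrals_eq_dumbbell_iff (μ := x) hc hr₁.le hr₁' hr₂ hr₂' hr hdom₁
  have hxlev : integrals c x = integrals c (dumbbell r₁ r₂) := by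
    rw [hlevel, xd, x3sq, x0, x1, x2]
    exact ⟨by ring, by ring, rfl⟩
  obtain ⟨⟨γ, hγ0, hγ, hγU⟩, hall⟩ := hstab x hxS hδ₁
  have hclose : ∀ t ≥ 0, dist (γ t) (dumbbell r₁ r₂) < (d₂ - d₀) / 4 := fun t ht =>
    -- The intervals in the definition are half-open, hence `t + 1` to include `t`.
    hall (t + 1) γ hγ0 (hγ.mono Ico_subset_Ici_self)
      (fun u hu => hγU u hu.1) t ⟨ht, lt_add_one t⟩
  have hlev : ∀ t ≥ 0, γ t 0 + γ t 1 = r₁ ^ 2 + r₂ ^ 2 ∧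
      γ t 0 + γ t 1 - 2 * γ t 2 = dumbbellDist c r₁ r₂ (γ t 0 - γ t 1) ∧
        4 * γ t 3 ^ 2 = dumbbellProfile c r₁ r₂ (γ t 0 - γ t 1) := by
    intro t ht
    rw [← integrals_eq_dumbbell_iff hc hr₁.le hr₁' hr₂ hr₂' hr (hγU t ht), ← hxlev, ← hγ0]
    exact eq_of_conserved (hγ.mono Icc_subset_Ici_self)
      (fun u hu => integrals_conserved hΓ hΓ0 (hγU u hu.1)) t ⟨ht, le_rfl⟩
  have hcoord : ∀ i, ContinuousOn (fun t => γ t i) (Ici 0) := fun i t ht =>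
    (hasFDerivAt_coord i (γ t)).continuousAt.comp_continuousWithinAt (hγ.continuousWithinAt ht)
  have hderiv : ∀ i, ∀ t > 0, HasDerivAt (fun t => γ t i) (lpField c Γ (γ t) i) t := fun i t ht =>
    (hasFDerivAt_coord i (γ t)).comp_hasDerivAt t ((hγ t ht.le).hasDerivAt (Ici_mem_nhds ht))
  have hdle : ∀ t ≥ 0, γ t 0 - γ t 1 ≤ (d₀ + d₂) / 2 := by
    intro t ht
    have e0 := (abs_le.mp (abs_coord_sub_le (γ t) (dumbbell r₁ r₂) 0)).2
    have e1 := (abs_le.mp (abs_coord_sub_le (γ t) (dumbbell r₁ r₂) 1)).1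
    have f0 : dumbbell r₁ r₂ 0 = r₁ ^ 2 := rfl
    have f1 : dumbbell r₁ r₂ 1 = r₂ ^ 2 := rfl
    rw [f0] at e0
    rw [f1] at e1
    linarith [hclose t ht]
  obtain ⟨B, hB0, hB⟩ : ∃ B, 0 < B ∧ ∀ t ≥ 0, γ t 0 + γ t 1 - 2 * γ t 2 ≤ B := by
    refine ⟨r₁ ^ 2 + r₂ ^ 2 + 2 * (r₁ * r₂) + (d₂ - d₀) / 2, by
      have := mul_nonneg hr₁.le hr₂
      have := sq_nonneg r₂
      have := sq_nonneg r₁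
      linarith, fun t ht => ?_⟩
    have e2 := (abs_le.mp (abs_coord_sub_le (γ t) (dumbbell r₁ r₂) 2)).1
    have f2 : dumbbell r₁ r₂ 2 = -(r₁ * r₂) := rfl
    rw [f2] at e2
    linarith [hclose t ht, (hlev t ht).1]
  have hI : Icc (γ 0 0 - γ 0 1) ((d₀ + d₂) / 2) ⊆ Ioo d₀ d₂ := by
    rw [hγ0, xd]
    exact fun y hy => ⟨hd₁.1.trans_le hy.1, hy.2.trans_lt (by linarith)⟩
  refine not_bounded_of_sq_eq (d := fun t => γ t 0 - γ t 1) (w := fun t => Γ 0 * γ t 3)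
    (q := fun t => 4 * c / (γ t 0 + γ t 1 - 2 * γ t 2)) (q₀ := 4 * c / B)
    (P := fun d => Γ 0 ^ 2 / 4 * dumbbellProfile c r₁ r₂ d) (d₁ := (d₀ + d₂) / 2)
    ((hcoord 0).sub (hcoord 1)) (continuousOn_const.mul (hcoord 3)) ?_ (by positivity) ?_
    (continuous_const.mul (continuous_dumbbellProfile hc)).continuousOn ?_ hdle ?_ ?_
  · intro t ht
    have := (hderiv 0 t ht).sub (hderiv 1 t ht)
    rw [lpField_eq hΓ hΓ0 (hγU t ht.le)] at this
    convert! this using 1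
    simp
    ring
  · intro t ht
    exact div_le_div_of_nonneg_left (by positivity) (hγU t ht.le).2.2 (hB t ht.le)
  · exact fun y hy => mul_pos (by positivity) (hpos (hI hy))
  · intro t ht
    rw [← (hlev t ht).2.2]
    ring
  · have : 0 < |Γ 0| := abs_pos.mpr hΓ0
    rw [hγ0, x3, mul_div_assoc', ← mul_assoc, hθΓ]
    positivity

/-! ### Passing from k back to d. -/

theorem tendsto_complProd_zero (σ : ℝ) :
    Tendsto (complProd σ) (𝓝[≠] 0) (𝓝[<] (complProd σ 0)) := by
  refine tendsto_nhdsWithin_iff.mpr ⟨(continuous_complProd σ).continuousAt.mono_left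
    nhdsWithin_le_nhds, ?_⟩
  filter_upwards [self_mem_nhdsWithin] with d hd
  have := sq_pos_of_ne_zero (show d ≠ 0 from hd)
  simp only [complProd, mem_Iio]
  linarith

/-- k is even in d and takes each value only at ±d; when `d₀ ≠ 0`, the mirror point `-d₀` is away
from `d₀`. -/
theorem tendsto_complProd (σ d₀ : ℝ) :
    Tendsto (complProd σ) (𝓝[≠] d₀) (𝓝[≠] (complProd σ d₀)) := by
  rcases eq_or_ne d₀ 0 with rfl | hd₀
  · exact (tendsto_complProd_zero σ).mono_right (nhdsLT_le_nhdsNE _)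
  · refine tendsto_nhdsWithin_iff.mpr ⟨(continuous_complProd σ).continuousAt.mono_left
      nhdsWithin_le_nhds, ?_⟩
    have hne : d₀ ≠ -d₀ := fun h => hd₀ (by linarith)
    filter_upwards [self_mem_nhdsWithin, nhdsWithin_le_nhds (isOpen_ne.mem_nhds hne)]
      with d hd hd' heq
    have : d ^ 2 = d₀ ^ 2 := by
      simp only [complProd, mem_singleton_iff] at heq
      linarith
    rcases sq_eq_sq_iff_eq_or_eq_neg.mp this with h | h
    · exact hd h
    · exact hd' h

theorem lpField_dumbbell_eq_zero (hΓ : Γ 0 = Γ 1) (hΓ0 : Γ 0 ≠ 0)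
    (hmem : dumbbell r₁ r₂ ∈ domain)
    (h : r₁ = r₂ ∨ c * (1 - r₁ ^ 2) * (1 - r₂ ^ 2) = r₁ * r₂ * (r₁ + r₂) ^ 2) :
    lpField c Γ (dumbbell r₁ r₂) = 0 := by
  rw [lpField_eq hΓ hΓ0 hmem]
  obtain ⟨h0, h1, h2⟩ := hmem
  have f0 : dumbbell r₁ r₂ 0 = r₁ ^ 2 := rfl
  have f1 : dumbbell r₁ r₂ 1 = r₂ ^ 2 := rfl
  have f2 : dumbbell r₁ r₂ 2 = -(r₁ * r₂) := rfl
  have f3 : dumbbell r₁ r₂ 3 = 0 := rfl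
  rw [f0] at h0
  rw [f1] at h1
  rw [f0, f1, f2] at h2
  have hs : r₁ ^ 2 + r₂ ^ 2 - 2 * -(r₁ * r₂) = (r₁ + r₂) ^ 2 := by ring
  rw [f0, f1, f2, f3, hs]
  rw [hs] at h2
  have h0' := (sub_pos.mpr h0).ne'
  have h1' := (sub_pos.mpr h1).ne'
  have h2' := h2.ne'
  have key : Γ 0 * (r₁ ^ 2 - r₂ ^ 2) *
      (c / (r₁ + r₂) ^ 2 + -(r₁ * r₂) / ((1 - r₁ ^ 2) * (1 - r₂ ^ 2))) = 0 := by
    rcases h with h | h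
    · simp [h]
    · have : c / (r₁ + r₂) ^ 2 + -(r₁ * r₂) / ((1 - r₁ ^ 2) * (1 - r₂ ^ 2)) = 0 := by
        rw [div_add_div _ _ h2' (mul_ne_zero h0' h1'), div_eq_zero_iff]
        left
        linarith
      rw [this, mul_zero]
  rw [key]
  ext i
  fin_cases i <;> simp

end BECVortex

/-! ### The two families of equilibria. -/

theorem mainTheorem4
    (c : ℝ) (hc : 0 < c) (Γ : Fin 2 → ℝ) (hΓ : Γ 0 = Γ 1) (hΓ0 : Γ 0 ≠ 0)
    (r₁ r₂ : ℝ) (hr₁ : 0 ≤ r₁) (hr₁' : r₁ < 1) (hr₂ : 0 ≤ r₂) (hr₂' : r₂ < 1)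
    (hr : 0 < r₁ + r₂) :
    -- equilibria A
    (r₁ = r₂ →
      BECVortex.lpField c Γ (BECVortex.dumbbell r₁ r₂) = 0 ∧
      (4 * r₁ ^ 4 < c * (1 - r₁ ^ 2) ^ 2 →
        BECVortex.LyapunovStable (BECVortex.lpField c Γ) BECVortex.domain
          (BECVortex.dumbbell r₁ r₂)) ∧
      (c * (1 - r₁ ^ 2) ^ 2 < 4 * r₁ ^ 4 →
        ¬ BECVortex.LyapunovStable (BECVortex.lpField c Γ) BECVortex.domain
          (BECVortex.dumbbell r₁ r₂) ∧
        ¬ BECVortex.LyapunovStableOn (BECVortex.lpField c Γ) BECVortex.domain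
          (Set.range BECVortex.shapeOf) (BECVortex.dumbbell r₁ r₂))) ∧
    -- equilibria B
    (c * (1 - r₁ ^ 2) * (1 - r₂ ^ 2) = r₁ * r₂ * (r₁ + r₂) ^ 2 →
      BECVortex.lpField c Γ (BECVortex.dumbbell r₁ r₂) = 0 ∧
      (BECVortex.F₁ r₁ r₂ < 0 →
        BECVortex.LyapunovStable (BECVortex.lpField c Γ) BECVortex.domain
          (BECVortex.dumbbell r₁ r₂)) ∧
      (0 < BECVortex.F₁ r₁ r₂ →
        ¬ BECVortex.LyapunovStable (BECVortex.lpField c Γ) BECVortex.domain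
          (BECVortex.dumbbell r₁ r₂) ∧
        ¬ BECVortex.LyapunovStableOn (BECVortex.lpField c Γ) BECVortex.domain
          (Set.range BECVortex.shapeOf) (BECVortex.dumbbell r₁ r₂))) := by
  have hmem := BECVortex.dumbbell_mem_domain hr₁ hr₁' hr₂ hr₂' hr
  have hnhds := BECVortex.isOpen_domain.mem_nhds hmem
  have k₁ := BECVortex.one_sub_sq_pos hr₁ hr₁'
  have k₂ := BECVortex.one_sub_sq_pos hr₂ hr₂'
  have hk := mul_pos k₁ k₂
  have hs : (0 : ℝ) < (r₁ + r₂) ^ 2 := by positivity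
  have hp0 := BECVortex.levelProfile_dumbbell (c := c) hr₁ hr₁' hr₂ hr₂'
  -- The numerator carries the threshold of A and vanishes exactly under condition B.
  have hp1 : BECVortex.levelProfileDeriv c ((1 - r₁ ^ 2) * (1 - r₂ ^ 2)) ((r₁ + r₂) ^ 2)
      (r₁ ^ 2 + r₂ ^ 2) ((1 - r₁ ^ 2) * (1 - r₂ ^ 2)) =
        4 * (c * (1 - r₁ ^ 2) * (1 - r₂ ^ 2) - r₁ * r₂ * (r₁ + r₂) ^ 2) /
          (c * ((1 - r₁ ^ 2) * (1 - r₂ ^ 2))) := by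
    rw [BECVortex.levelProfileDeriv_self hk]
    field_simp
    ring
  have hunstable : 0 < r₁ →
      (∀ᶠ d in nhdsWithin (r₁ ^ 2 - r₂ ^ 2) (Ioi (r₁ ^ 2 - r₂ ^ 2)),
        0 < BECVortex.dumbbellProfile c r₁ r₂ d) →
      ¬ BECVortex.LyapunovStable (BECVortex.lpField c Γ) BECVortex.domain
          (BECVortex.dumbbell r₁ r₂) ∧
        ¬ BECVortex.LyapunovStableOn (BECVortex.lpField c Γ) BECVortex.domain
          (Set.range BECVortex.shapeOf) (BECVortex.dumbbell r₁ r₂) := by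
    intro hr₁0 h
    have hnot := BECVortex.not_lyapunovStableOn_dumbbell hc hr₁' hr₂ hr₂' hr₁0 hΓ hΓ0 h
    exact ⟨fun hst => hnot (hst.on hnhds _), hnot⟩
  constructor
  · intro heq
    have hd : r₁ ^ 2 - r₂ ^ 2 = 0 := by rw [heq, sub_self]
    have htend := BECVortex.tendsto_complProd_zero (r₁ ^ 2 + r₂ ^ 2)
    rw [← hd, BECVortex.complProd_dumbbell] at htend
    have hnum : c * (1 - r₁ ^ 2) * (1 - r₂ ^ 2) - r₁ * r₂ * (r₁ + r₂) ^ 2 =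
        c * (1 - r₁ ^ 2) ^ 2 - 4 * r₁ ^ 4 := by
      rw [← heq]
      ring
    refine ⟨BECVortex.lpField_dumbbell_eq_zero hΓ hΓ0 hmem (Or.inl heq), fun h => ?_, fun h => ?_⟩
    · refine BECVortex.lyapunovStable_dumbbell hc hr₁ hr₁' hr₂ hr₂' hr hΓ hΓ0
        (htend.eventually (BECVortex.eventually_levelProfile_neg_left hk hp0 ?_))
      rw [hp1, hnum]
      exact div_pos (by linarith) (mul_pos hc hk)
    · refine hunstable (by linarith) (nhdsWithin_mono _ (fun d hd => ne_of_gt hd)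
        (htend.eventually (BECVortex.eventually_levelProfile_pos_left hk hp0 ?_)))
      rw [hp1, hnum]
      exact div_neg_of_neg_of_pos (by linarith) (mul_pos hc hk)
  · intro hB
    -- Needed to realise nearby rank-one shapes by configurations; `r₁ = 0` would make the positive
    -- left side of `hB` vanish.
    have hr₁0 : 0 < r₁ := by
      rcases hr₁.eq_or_lt with h | h
      · rw [← h] at hB hk
        simp only [zero_mul] at hB
        have := mul_pos hc hk
        linarith
      · exact h
    have htend := BECVortex.tendsto_complProd (r₁ ^ 2 + r₂ ^ 2) (r₁ ^ 2 - r₂ ^ 2)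
    rw [BECVortex.complProd_dumbbell] at htend
    rw [hB, sub_self, mul_zero, zero_div] at hp1
    -- The sign factor of the second derivative, times k₀ > 0; condition B replaces c k₀ by r₁r₂(r₁
    -- + r₂)².
    have hF : ((1 - r₁ ^ 2) * (1 - r₂ ^ 2)) * (r₁ ^ 2 + r₂ ^ 2 - 2 * (r₁ + r₂) ^ 2
        - c * (r₁ ^ 2 + r₂ ^ 2 - (r₁ + r₂) ^ 2)) = BECVortex.F₁ r₁ r₂ := by
      rw [BECVortex.F₁]
      linear_combination 2 * r₁ * r₂ * hB
    refine ⟨BECVortex.lpField_dumbbell_eq_zero hΓ hΓ0 hmem (Or.inr hB), fun h => ?_, fun h => ?_⟩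
    · rw [← hF] at h
      exact BECVortex.lyapunovStable_dumbbell hc hr₁ hr₁' hr₂ hr₂' hr hΓ hΓ0
        (htend.eventually (BECVortex.eventually_levelProfile_neg hk hc hs hp0 hp1
          (neg_of_mul_neg_right h hk.le)))
    · rw [← hF] at h
      exact hunstable hr₁0 (nhdsWithin_mono _ (fun d hd => ne_of_gt hd)
        (htend.eventually (BECVortex.eventually_levelProfile_pos hk hc hs hp0 hp1
          (pos_of_mul_pos_right h hk.le))))
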